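/- **Theorem.** Consider a Markov decision process with a finite state space $S$, finite nonempty action sets $A(s)$, $\mathcal K=\{(s,a): s\in S, a\in A(s)\}$, transition probabilities $p(s,a,s')$, initial distribution $\gamma$ on $S$, and discount factor $\alpha\in(0,1)$. Let $$\mathcal Q_\alpha(\gamma)=\Big\{\rho\in\mathbb R^{|\mathcal K|}:\ \sum_{(s,a)\in\mathcal K}\rho(s,a)\big(\delta(s',s)-\alpha p(s,a,s')\big)=(1-\alpha)\gamma(s')\ \ \forall s'\in S,\quad \rho(s,a)\ge 0\ \ \forall (s,a)\in\mathcal K\Big\},$$ where $\delta$ is the Kronecker delta. Let $\epsilon\in(0,1)$, $\theta_W>0$, $H\ge1$, $\tilde\xi_1,\dots,\tilde\xi_H\in\mathbb R^{|\mathcal K|}$, and let $\nu=\frac1H\sum_{i=1}^H\delta_{\tilde\xi_i}$. Let $\mathcal D$ be the set of Borel probability measures $F$ on $\mathbb R^{|\mathcal K|}$ with finite first moment and $W_1(F,\nu)\le\theta_W$, where $$W_1(F,\nu)=\inf_{\pi}\int \|x-z\|_2\,\pi(dx,dz),$$ the infimum being over all probability measures $\pi$ on $\mathbb R^{|\mathcal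 K|}\times\mathbb R^{|\mathcal K|}$ with marginals $F$ and $\nu$. Consider the distributionally robust chance-constrained problem $$\text{(DRCCMDP)}\qquad \sup_{y\in\mathbb R,\ \rho}\ y\quad\text{s.t.}\quad \sup_{F\in\mathcal D}F\big(\{x:\rho^{T}x\le y\}\big)\le\epsilon,\qquad \rho\in\mathcal Q_\alpha(\gamma),$$ and, with $M=\frac{\theta_W}{\epsilon}+2\max_{1\le i\le H}\|\tilde\xi_i\|_2$, the mixed-integer second-order cone program in the variables $y,\rho,\beta,t,b=(b_i)_{i=1}^H,\eta=(\eta_i)_{i=1}^H$ $$\text{(MISOCP)}\qquad \begin{aligned} \max\ \ & y\\ \text{s.t.}\ \ & \beta\theta_W-\tfrac1H\textstyle\sum_{i=1}^H b_i\le t\epsilon,\\ & M\eta_i\ge b_i+t,\quad i=1,\dots,H,\\ & M(1-\eta_i)+\rho^{T}\tilde\xi_i-y\ge b_i+t,\quad i=1,\dots,H,\\ & \eta_i\in\{0,1\},\ b_i\le 0,\quad i=1,\dots,H,\\ & \|\rho\|_2\le\beta,\ t\ge0,\ \beta>0,\ \rho\in\mathcal Q_\alpha(\gamma). \end{aligned}$$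 Then the two problems are equivalent: a pair $(y,\rho)$ is feasible for (DRCCMDP) if and only if there exist $\beta,t,b,\eta$ such that $(y,\rho,\beta,t,b,\eta)$ is feasible for (MISOCP). Moreover, the maximum in (MISOCP) is finite and attained, and it equals the supremum in (DRCCMDP). -/

import Mathlib

open MeasureTheory
open scoped ENNReal

noncomputable section

/-- The set of state-action pairs of a Markov decision process with state space `S` and with
action set `A s` at the state `s`. -/
abbrev StateAction (S : Type*) (A : S → Type*) : Type _ := (s : S) × A s

/-- The polytope of discounted occupation measures, for the discount factor `α`, the
transition probabilities `p s a s'` and the initial distribution `γ`. -/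
def occupationPolytope {S : Type*} [Fintype S] [DecidableEq S] {A : S → Type*}
    [∀ s, Fintype (A s)] (α : ℝ) (p : (s : S) → A s → S → ℝ) (γ : S → ℝ) :
    Set (EuclideanSpace ℝ (StateAction S A)) :=
  {ρ | (∀ s' : S, ∑ k : StateAction S A,
          ρ k * ((if s' = k.1 then (1 : ℝ) else 0) - α * p k.1 k.2 s') = (1 - α) * γ s') ∧
       ∀ k, 0 ≤ ρ k}

/-- Couplings of two measures: measures on the product with the given marginals. -/
def couplings {E : Type*} [MeasurableSpace E] (μ ν : Measure E) : Set (Measure (E × E)) :=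
  {π | IsProbabilityMeasure π ∧ π.map Prod.fst = μ ∧ π.map Prod.snd = ν}

/-- The `p`-Wasserstein distance, with values in `[0, ∞]`. -/
def wassersteinDist {E : Type*} [MeasurableSpace E] [MetricSpace E] (p : ℝ)
    (μ ν : Measure E) : ℝ≥0∞ :=
  (⨅ π ∈ couplings μ ν, ∫⁻ z, edist z.1 z.2 ^ p ∂π) ^ (1 / p)

/-- Probability measures on `E` with a finite `p`-th moment. -/
def finiteMomentMeasures (E : Type*) [MeasurableSpace E] [MetricSpace E] (p : ℝ) :
    Set (Measure E) :=
  {μ | IsProbabilityMeasure μ ∧ ∃ x₀ : E, ∫⁻ x, edist x x₀ ^ p ∂μ < ∞}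

/-- The Wasserstein uncertainty set: the ball of radius `θ` around `ν`, with support the whole
space `E`. -/
def wassersteinBall {E : Type*} [MeasurableSpace E] [MetricSpace E] (ν : Measure E)
    (p θ : ℝ) : Set (Measure E) :=
  {F | F ∈ finiteMomentMeasures E p ∧ wassersteinDist p F ν ≤ ENNReal.ofReal θ}

/-- The empirical distribution of the scenarios `ξ 0, …, ξ (H - 1)`, each of weight `1 / H`. -/
def empiricalMeasure {E : Type*} [MeasurableSpace E] {H : ℕ} (ξ : Fin H → E) : Measure E :=
  (H : ℝ≥0∞)⁻¹ • ∑ i, Measure.dirac (ξ i)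

/-- Feasibility of `(y, ρ)` for the distributionally robust chance constrained problem
"maximize `y`", with uncertainty set `D` for the law of the reward vector, with confidence
level `1 - ε`, and with `ρ` ranging over `Q`. -/
def DRCCFeasible {K : Type*} [Fintype K] (D : Set (Measure (EuclideanSpace ℝ K))) (ε : ℝ)
    (Q : Set (EuclideanSpace ℝ K)) (y : ℝ) (ρ : EuclideanSpace ℝ K) : Prop :=
  (⨆ F ∈ D, F {x | inner ℝ ρ x ≤ y}) ≤ ENNReal.ofReal ε ∧ ρ ∈ Q

/-- The big-M constant `θ / ε + 2 max_i ‖ξ i‖₂`. -/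
def bigM {K : Type*} [Fintype K] {H : ℕ} (ξ : Fin H → EuclideanSpace ℝ K) (θ ε : ℝ) : ℝ :=
  θ / ε + 2 * ⨆ i, ‖ξ i‖

/-- Feasibility of `(y, ρ, β, t, b, η)` for the mixed-integer second-order cone program
"maximize `y`". -/
structure MISOCPFeasible {K : Type*} [Fintype K] {H : ℕ} (ξ : Fin H → EuclideanSpace ℝ K)
    (θ ε : ℝ) (Q : Set (EuclideanSpace ℝ K)) (y : ℝ) (ρ : EuclideanSpace ℝ K) (β t : ℝ)
    (b η : Fin H → ℝ) : Prop where
  budget : β * θ - (1 / (H : ℝ)) * ∑ i, b i ≤ t * ε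
  switch_off : ∀ i, b i + t ≤ bigM ξ θ ε * η i
  switch_on : ∀ i, b i + t ≤ bigM ξ θ ε * (1 - η i) + inner ℝ ρ (ξ i) - y
  binary : ∀ i, η i = 0 ∨ η i = 1
  cone : ‖ρ‖ ≤ β
  t_nonneg : 0 ≤ t
  beta_pos : 0 < β
  mem : ρ ∈ Q
  b_nonpos : ∀ i, b i ≤ 0

end

/-!
Both problems reduce to one scalar certificate. For `ρ ≠ 0` write `g x = (⟪ρ, x⟫ - y)⁺`
(`halfSpaceGap`), which is `‖ρ‖` times the distance from `x` to the half-space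
`C = {x | ⟪ρ, x⟫ ≤ y}`. Both kinds of feasibility turn out to be
equivalent to the existence of `t ≥ 0` with
`‖ρ‖ * θ + (1 / H) * ∑ i, (t - g (ξ i))⁺ ≤ t * ε` (`IsDualMultiplier`).

* If such a `t` exists, integrating `t * 1_C x ≤ ‖ρ‖ * dist x z + (t - g z)⁺` against couplings
  bounds `F C` by `ε` for every `F` in the Wasserstein ball
  (`measure_halfSpace_le_of_isDualMultiplier`). Conversely, the laws obtained by moving a fraction
  `q i` of the atom at `ξ i` to its projection on `C` lie in the ball as long as
  `∑ q i * g (ξ i) ≤ H * ‖ρ‖ * θ`. So the chance constraint bounds the value of a fractional knapsack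
  problem, and `t` is the optimal threshold of that problem
  (`exists_isDualMultiplier_of_measure_halfSpace_le`). No general Kantorovich duality is needed.
* The mixed-integer program linearizes the certificate, with `β = ‖ρ‖`, `b i = -(t - g (ξ i))⁺` and
  `η i` indicating `g (ξ i) > 0`. Since `ρ` is a probability vector, `‖ρ‖ ≤ 1`, whence the gaps
  differ by at most `2 * max ‖ξ i‖`, and the constant `M` suffices once `t` is chosen well
  (`exists_misocpFeasible_iff`).

The optimum is attained because the polytope of occupation measures is compact and nonempty and the
certificates of good values of `y` form a compact set (`exists_isGreatest_isDualMultiplier`).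
-/

/-! ### Discounted occupation measures -/

/-- The discounted occupation measure of an arbitrary stationary deterministic policy lies in the
polytope. -/
theorem occupationPolytope_nonempty {S : Type*} [Fintype S] [DecidableEq S] {A : S → Type*}
    [∀ s, Fintype (A s)] [∀ s, Nonempty (A s)] {α : ℝ} (hα0 : 0 < α) (hα1 : α < 1)
    {p : (s : S) → A s → S → ℝ} (hp0 : ∀ s a s', 0 ≤ p s a s')
    (hp1 : ∀ s a, ∑ s', p s a s' = 1) {γ : S → ℝ} (hγ0 : ∀ s, 0 ≤ γ s) (hγ1 : ∑ s, γ s = 1) :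
    (occupationPolytope α p γ).Nonempty := by
  classical
  let f : (s : S) → A s := fun s => Classical.arbitrary _
  -- the law of the state at time `n` under the policy `f`
  let v : ℕ → S → ℝ := fun n => Nat.rec γ (fun _ w s' => ∑ s, w s * p s (f s) s') n
  have hvs : ∀ n s', v (n + 1) s' = ∑ s, v n s * p s (f s) s' := fun _ _ => rfl
  have hv0 : ∀ n s, 0 ≤ v n s := by
    intro n
    induction n with
    | zero => exact hγ0
    | succ n ih => exact fun s' => Finset.sum_nonneg fun s _ => mul_nonneg (ih s) (hp0 _ _ _)
  have hv1 : ∀ n, ∑ s, v n s = 1 := by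
    intro n
    induction n with
    | zero => exact hγ1
    | succ n ih =>
      simp_rw [hvs]
      rw [Finset.sum_comm]
      simp_rw [← Finset.mul_sum, hp1, mul_one, ih]
  have hsum : ∀ s, Summable fun n => α ^ n * v n s := fun s =>
    (summable_geometric_of_lt_one hα0.le hα1).of_nonneg_of_le
      (fun n => mul_nonneg (pow_nonneg hα0.le n) (hv0 n s))
      (fun n => mul_le_of_le_one_right (pow_nonneg hα0.le n)
        ((Finset.single_le_sum (fun s _ => hv0 n s) (Finset.mem_univ s)).trans_eq (hv1 n)))
  -- the discounted sum of these laws solves the fixed-point equation `u = γ + α u P`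
  let u : S → ℝ := fun s => ∑' n, α ^ n * v n s
  have hu0 : ∀ s, 0 ≤ u s := fun s => tsum_nonneg fun n =>
    mul_nonneg (pow_nonneg hα0.le n) (hv0 n s)
  have hu : ∀ s', u s' = γ s' + α * ∑ s, u s * p s (f s) s' := by
    intro s'
    have h1 : HasSum (fun n => α * ∑ s, α ^ n * v n s * p s (f s) s')
        (α * ∑ s, u s * p s (f s) s') :=
      (hasSum_sum fun s _ => (hsum s).hasSum.mul_right _).mul_left α
    have h2 : (fun n => α * ∑ s, α ^ n * v n s * p s (f s) s')
        = fun n => α ^ (n + 1) * v (n + 1) s' := by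
      funext n
      rw [hvs, pow_succ', Finset.mul_sum, Finset.mul_sum]
      exact Finset.sum_congr rfl fun s _ => by ring
    rw [h2] at h1
    have h3 := (hsum s').tsum_eq_zero_add
    rw [h1.tsum_eq] at h3
    simpa [u, v] using h3
  refine ⟨WithLp.toLp 2 fun k => if k.2 = f k.1 then (1 - α) * u k.1 else 0, fun s' => ?_,
    fun k => ?_⟩
  · have : ∀ s : S, ∑ a : A s, (if a = f s then (1 - α) * u s else 0) *
        ((if s' = s then (1 : ℝ) else 0) - α * p s a s')
        = (1 - α) * ((if s' = s then u s else 0) - α * (u s * p s (f s) s')) := by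
      intro s
      rw [Finset.sum_eq_single (f s) (fun a _ ha => by simp [ha]) (by simp)]
      rw [if_pos rfl]
      split_ifs <;> ring
    rw [Fintype.sum_sigma]
    simp only [this]
    rw [← Finset.mul_sum, Finset.sum_sub_distrib, ← Finset.mul_sum]
    have := hu s'
    simp only [Finset.sum_ite_eq, Finset.mem_univ, if_true]
    rw [this]
    ring
  · change 0 ≤ if k.2 = f k.1 then (1 - α) * u k.1 else 0
    split_ifs
    · exact mul_nonneg (by linarith) (hu0 _)
    · exact le_rfl

/-- Sum the balance equations over all states. -/
theorem sum_eq_one_of_mem_occupationPolytope {S : Type*} [Fintype S] [DecidableEq S]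
    {A : S → Type*} [∀ s, Fintype (A s)] {α : ℝ} (hα1 : α < 1)
    {p : (s : S) → A s → S → ℝ} (hp1 : ∀ s a, ∑ s', p s a s' = 1) {γ : S → ℝ}
    (hγ1 : ∑ s, γ s = 1) {ρ : EuclideanSpace ℝ (StateAction S A)}
    (hρ : ρ ∈ occupationPolytope α p γ) : ∑ k, ρ k = 1 := by
  have h := Finset.sum_congr (rfl : (Finset.univ : Finset S) = _) fun s' _ => hρ.1 s'
  rw [Finset.sum_comm, ← Finset.mul_sum, hγ1] at h
  simp_rw [← Finset.mul_sum, Finset.sum_sub_distrib, ← Finset.mul_sum, hp1] at h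
  simp only [Finset.sum_ite_eq', Finset.mem_univ, if_true, mul_one] at h
  rw [← Finset.sum_mul] at h
  exact mul_right_cancel₀ (sub_pos.2 hα1).ne' (h.trans (one_mul _).symm)

theorem norm_le_one_of_nonneg_of_sum_eq_one {K : Type*} [Fintype K] {ρ : EuclideanSpace ℝ K}
    (h0 : ∀ k, 0 ≤ ρ k) (h1 : ∑ k, ρ k = 1) : ‖ρ‖ ≤ 1 := by
  rw [← sq_le_one_iff₀ (norm_nonneg _), EuclideanSpace.real_norm_sq_eq, ← h1]
  refine Finset.sum_le_sum fun k _ => ?_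
  have : ρ k ≤ 1 := h1 ▸ Finset.single_le_sum (fun k _ => h0 k) (Finset.mem_univ k)
  nlinarith [h0 k]

theorem isClosed_occupationPolytope {S : Type*} [Fintype S] [DecidableEq S]
    {A : S → Type*} [∀ s, Fintype (A s)] (α : ℝ) (p : (s : S) → A s → S → ℝ) (γ : S → ℝ) :
    IsClosed (occupationPolytope α p γ) := by
  simp only [occupationPolytope, Set.ofPred_and, Set.ofPred_forall]
  refine (isClosed_iInter fun s' => isClosed_eq (by fun_prop) continuous_const).inter
    (isClosed_iInter fun k => isClosed_le continuous_const (by fun_prop))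

/-! ### Duality for the fractional knapsack problem -/

/-- Strong duality for the fractional knapsack problem `max ∑ q i` subject to `∑ q i * g i ≤ B` and
`0 ≤ q i ≤ 1`: if the optimum is at most `m`, some threshold `t` certifies it. The threshold is the
quantile of the costs `g` of order `m`: filling the cheapest items up to total size `m` costs
`t * m - ∑ i, (t - g i)⁺`, which must be at least `B`, for otherwise there is room for more. -/
theorem exists_threshold_of_fractional_knapsack {ι : Type*} [Fintype ι] {g : ι → ℝ}
    (hg : ∀ i, 0 ≤ g i) {B m : ℝ} (hm0 : 0 < m) (hm1 : m < Fintype.card ι)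
    (h : ∀ q : ι → ℝ, (∀ i, 0 ≤ q i) → (∀ i, q i ≤ 1) → ∑ i, q i * g i ≤ B → ∑ i, q i ≤ m) :
    ∃ t, 0 ≤ t ∧ B + ∑ i, max (t - g i) 0 ≤ t * m := by
  classical
  have : Nonempty ι := by
    by_contra hne
    rw [not_nonempty_iff] at hne
    simp at hm1
    linarith
  set N : ℝ → ℝ := fun t => ((Finset.univ.filter fun i => g i ≤ t).card : ℝ) with hN
  obtain ⟨jmax, -, hjmax⟩ := Finset.exists_max_image Finset.univ g Finset.univ_nonempty
  obtain ⟨j, hj, hjmin⟩ := Finset.exists_min_image (Finset.univ.filter fun j => m ≤ N (g j)) g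
    ⟨jmax, by
      have : (Finset.univ.filter fun i => g i ≤ g jmax) = Finset.univ :=
        Finset.filter_true_of_mem fun i hi => hjmax i hi
      simp only [hN, Finset.mem_filter, Finset.mem_univ, true_and, this, Finset.card_univ]
      exact hm1.le⟩
  simp only [Finset.mem_filter, Finset.mem_univ, true_and] at hj hjmin
  set t := g j with ht
  refine ⟨t, hg j, ?_⟩
  by_contra hcon
  push Not at hcon
  set L := Finset.univ.filter fun i => g i < t with hL
  set T := Finset.univ.filter fun i => g i = t with hT
  have hLm : (L.card : ℝ) < m := by
    rcases L.eq_empty_or_nonempty with he | hne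
    · simpa [he] using hm0
    · obtain ⟨k, hk, hkmax⟩ := Finset.exists_max_image L g hne
      by_contra hc
      push Not at hc
      have hkt : g k < t := by simpa [hL] using hk
      have : m ≤ N (g k) := by
        refine hc.trans ?_
        simp only [hN]
        exact_mod_cast Finset.card_le_card fun i hi => by simpa using hkmax i hi
      exact absurd (hjmin k this) (not_le.2 hkt)
  have hNT : N t = L.card + T.card := by
    simp only [hN, hL, hT]
    rw [← Nat.cast_add, ← Finset.card_union_of_disjoint]
    · congr 2
      ext i
      simp [le_iff_lt_or_eq]
    · rw [Finset.disjoint_filter]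
      intro i _ h1 h2
      exact absurd h2 h1.ne
  have hTpos : 0 < (T.card : ℝ) := by linarith
  -- all the mass strictly below the threshold, and the same fraction of each item at it
  set c : ℝ := (m - L.card) / T.card with hc
  have hc0 : 0 ≤ c := div_nonneg (by linarith) hTpos.le
  have hc1 : c ≤ 1 := by rw [hc, div_le_one hTpos]; linarith
  have hcT : T.card * c = m - L.card := by rw [hc]; field_simp
  set q : ι → ℝ := fun i => if g i < t then 1 else if g i = t then c else 0 with hq
  have hq0 : ∀ i, 0 ≤ q i := fun i => by simp only [hq]; split_ifs <;> linarith
  have hq1 : ∀ i, q i ≤ 1 := fun i => by simp only [hq]; split_ifs <;> linarith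
  have hqs : ∑ i, q i = m := by
    have : ∀ i, q i = (if g i < t then 1 else 0) + c * (if g i = t then 1 else 0) := fun i => by
      simp only [hq]
      rcases lt_trichotomy (g i) t with h1 | h1 | h1
      · simp [h1, h1.ne]
      · simp [h1]
      · simp [h1.not_gt, h1.ne']
    simp_rw [this, Finset.sum_add_distrib, ← Finset.mul_sum, Finset.sum_boole]
    linarith [mul_comm c (T.card : ℝ)]
  have hqg : ∑ i, q i * g i = t * m - ∑ i, max (t - g i) 0 := by
    rw [← hqs, Finset.mul_sum, ← Finset.sum_sub_distrib]
    refine Finset.sum_congr rfl fun i _ => ?_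
    simp only [hq]
    rcases lt_trichotomy (g i) t with h1 | h1 | h1
    · rw [if_pos h1, max_eq_left (by linarith)]; ring
    · simp [h1]; ring
    · rw [if_neg h1.not_gt, if_neg h1.ne', max_eq_right (by linarith)]; ring
  have hslack : 0 < B - ∑ i, q i * g i := by linarith
  have hG : 0 ≤ ∑ i, g i := Finset.sum_nonneg fun i _ => hg i
  -- the unused budget pays for a slight increase of every fraction
  obtain ⟨s, hs0, hs1, hsB⟩ : ∃ s : ℝ, 0 < s ∧ s ≤ 1 ∧ s * ∑ i, g i ≤ B - ∑ i, q i * g i := by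
    refine ⟨min 1 ((B - ∑ i, q i * g i) / (∑ i, g i + 1)), ?_, min_le_left _ _, ?_⟩
    · exact lt_min one_pos (div_pos hslack (by linarith))
    · calc _ ≤ (B - ∑ i, q i * g i) / (∑ i, g i + 1) * (∑ i, g i + 1) :=
            mul_le_mul (min_le_right _ _) (by linarith) hG (div_pos hslack (by linarith)).le
        _ = _ := div_mul_cancel₀ _ (by linarith)
  have key := h (fun i => q i + s * (1 - q i))
    (fun i => by have := mul_nonneg hs0.le (sub_nonneg.2 (hq1 i)); linarith [hq0 i])
    (fun i => by nlinarith [hq1 i]) (by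
      have : ∑ i, (q i + s * (1 - q i)) * g i ≤ ∑ i, (q i * g i + s * g i) :=
        Finset.sum_le_sum fun i _ => by
          nlinarith [mul_nonneg hs0.le (mul_nonneg (hq0 i) (hg i))]
      rw [Finset.sum_add_distrib, ← Finset.mul_sum] at this
      linarith)
  rw [Finset.sum_add_distrib, ← Finset.mul_sum, Finset.sum_sub_distrib, hqs] at key
  simp only [Finset.sum_const, Finset.card_univ, nsmul_eq_mul, mul_one] at key
  nlinarith [mul_pos hs0 (sub_pos.2 hm1)]

/-! ### Half-spaces and dual certificates -/

/-- The excess `(⟪ρ, x⟫ - y)⁺`. When `ρ ≠ 0` this is `‖ρ‖` times the distance from `x` to the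
half-space `{x | ⟪ρ, x⟫ ≤ y}`. -/
noncomputable def halfSpaceGap {E : Type*} [NormedAddCommGroup E] [InnerProductSpace ℝ E] (ρ : E)
    (y : ℝ) (x : E) : ℝ :=
  max (inner ℝ ρ x - y) 0

theorem halfSpaceGap_nonneg {E : Type*} [NormedAddCommGroup E] [InnerProductSpace ℝ E] (ρ : E)
    (y : ℝ) (x : E) : 0 ≤ halfSpaceGap ρ y x :=
  le_max_right _ _

theorem inner_sub_le_halfSpaceGap {E : Type*} [NormedAddCommGroup E] [InnerProductSpace ℝ E]
    (ρ : E) (y : ℝ) (x : E) : inner ℝ ρ x - y ≤ halfSpaceGap ρ y x :=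
  le_max_left _ _

/-- `t` certifies that every law within Wasserstein distance `θ` of the empirical measure of `ξ`
gives the half-space `{x | ⟪ρ, x⟫ ≤ y}` mass at most `ε`. In terms of the multiplier `l = ‖ρ‖ / t`
of the transport budget and of the distance `d i` from `ξ i` to the half-space, this is
`l * θ + (1 / H) * ∑ i, (1 - l * d i)⁺ ≤ ε`, cleared of the denominator `t`. -/
def IsDualMultiplier {E : Type*} [NormedAddCommGroup E] [InnerProductSpace ℝ E] {H : ℕ}
    (ξ : Fin H → E) (θ ε y : ℝ) (ρ : E) (t : ℝ) : Prop :=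
  0 ≤ t ∧ ‖ρ‖ * θ + 1 / (H : ℝ) * ∑ i, max (t - halfSpaceGap ρ y (ξ i)) 0 ≤ t * ε

/-! ### Moving mass of an empirical measure -/

section Split

variable {X : Type*} [MeasurableSpace X] {H : ℕ}

/-- The empirical measure of `v` with the fraction `q i` of the atom at `v i` moved to `u i`. It is
a probability measure when `0 ≤ q i ≤ 1`. -/
noncomputable def splitEmpiricalMeasure (q : Fin H → ℝ) (u v : Fin H → X) : Measure X :=
  (H : ℝ≥0∞)⁻¹ • ∑ i, (ENNReal.ofReal (q i) • Measure.dirac (u i) +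
    ENNReal.ofReal (1 - q i) • Measure.dirac (v i))

theorem splitEmpiricalMeasure_self {q : Fin H → ℝ} (h0 : ∀ i, 0 ≤ q i) (h1 : ∀ i, q i ≤ 1)
    (v : Fin H → X) : splitEmpiricalMeasure q v v = empiricalMeasure v := by
  simp only [splitEmpiricalMeasure, empiricalMeasure]
  congr 1
  refine Finset.sum_congr rfl fun i _ => ?_
  rw [← add_smul, ← ENNReal.ofReal_add (h0 i) (sub_nonneg.2 (h1 i))]
  simp

theorem map_splitEmpiricalMeasure {Y : Type*} [MeasurableSpace Y] (q : Fin H → ℝ)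
    (u v : Fin H → X) {f : X → Y} (hf : Measurable f) :
    (splitEmpiricalMeasure q u v).map f =
      splitEmpiricalMeasure q (fun i => f (u i)) fun i => f (v i) := by
  simp only [splitEmpiricalMeasure]
  rw [Measure.map_smul, Measure.map_finset_sum hf.aemeasurable]
  simp only [Measure.map_add _ _ hf, Measure.map_smul, Measure.map_dirac' hf]

theorem lintegral_splitEmpiricalMeasure [MeasurableSingletonClass X] (q : Fin H → ℝ)
    (u v : Fin H → X) (f : X → ℝ≥0∞) :
    ∫⁻ x, f x ∂splitEmpiricalMeasure q u v =
      (H : ℝ≥0∞)⁻¹ *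
        ∑ i, (ENNReal.ofReal (q i) * f (u i) + ENNReal.ofReal (1 - q i) * f (v i)) := by
  simp only [splitEmpiricalMeasure, lintegral_smul_measure, lintegral_finsetSum_measure,
    lintegral_add_measure, lintegral_dirac, smul_eq_mul]

theorem lintegral_empiricalMeasure [MeasurableSingletonClass X] (v : Fin H → X)
    (f : X → ℝ≥0∞) :
    ∫⁻ x, f x ∂empiricalMeasure v = (H : ℝ≥0∞)⁻¹ * ∑ i, f (v i) := by
  simp only [empiricalMeasure, lintegral_smul_measure, lintegral_finsetSum_measure,
    lintegral_dirac, smul_eq_mul]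

theorem inv_natCast_mul_sum_ofReal (hH : 0 < H) {a : Fin H → ℝ} (ha : ∀ i, 0 ≤ a i) :
    (H : ℝ≥0∞)⁻¹ * ∑ i, ENNReal.ofReal (a i) = ENNReal.ofReal (1 / (H : ℝ) * ∑ i, a i) := by
  have hH' : (0 : ℝ) < H := by exact_mod_cast hH
  rw [ENNReal.ofReal_mul (by positivity), ENNReal.ofReal_sum_of_nonneg fun i _ => ha i,
    one_div, ENNReal.ofReal_inv_of_pos hH', ENNReal.ofReal_natCast]

theorem isProbabilityMeasure_splitEmpiricalMeasure [MeasurableSingletonClass X] (hH : 0 < H)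
    {q : Fin H → ℝ} (h0 : ∀ i, 0 ≤ q i) (h1 : ∀ i, q i ≤ 1) (u v : Fin H → X) :
    IsProbabilityMeasure (splitEmpiricalMeasure q u v) := by
  constructor
  rw [← setLIntegral_one, Measure.restrict_univ, lintegral_splitEmpiricalMeasure]
  have : ∀ i, ENNReal.ofReal (q i) * 1 + ENNReal.ofReal (1 - q i) * 1 = 1 := fun i => by
    rw [mul_one, mul_one, ← ENNReal.ofReal_add (h0 i) (sub_nonneg.2 (h1 i))]
    simp
  rw [Finset.sum_congr rfl fun i _ => this i, Finset.sum_const, Finset.card_univ,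
    Fintype.card_fin, nsmul_eq_mul, mul_one]
  exact ENNReal.inv_mul_cancel (by exact_mod_cast hH.ne') (ENNReal.natCast_ne_top H)

/-- Moving the fraction `q i` of each atom costs at most `(1 / H) * ∑ i, q i * dist (u i) (v i)`:
the coupling is itself a split empirical measure, on pairs. -/
theorem splitEmpiricalMeasure_mem_wassersteinBall {E : Type*} [MeasurableSpace E] [MetricSpace E]
    [MeasurableSingletonClass E] (hH : 0 < H)
    {q : Fin H → ℝ} (h0 : ∀ i, 0 ≤ q i) (h1 : ∀ i, q i ≤ 1) (u v : Fin H → E) {θ : ℝ}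
    (hcost : 1 / (H : ℝ) * ∑ i, q i * dist (u i) (v i) ≤ θ) :
    splitEmpiricalMeasure q u v ∈ wassersteinBall (empiricalMeasure v) 1 θ := by
  refine ⟨⟨isProbabilityMeasure_splitEmpiricalMeasure hH h0 h1 u v, v ⟨0, hH⟩, ?_⟩, ?_⟩
  · simp only [ENNReal.rpow_one]
    rw [lintegral_splitEmpiricalMeasure]
    refine ENNReal.mul_lt_top (by simpa using hH) (ENNReal.sum_lt_top.2 fun i _ => ?_)
    exact ENNReal.add_lt_top.2 ⟨ENNReal.mul_lt_top ENNReal.ofReal_lt_top (edist_lt_top _ _),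
      ENNReal.mul_lt_top ENNReal.ofReal_lt_top (edist_lt_top _ _)⟩
  · simp only [wassersteinDist, ENNReal.rpow_one, div_one]
    refine (iInf₂_le (splitEmpiricalMeasure q (fun i => (u i, v i)) fun i => (v i, v i))
      ⟨isProbabilityMeasure_splitEmpiricalMeasure hH h0 h1 _ _,
        map_splitEmpiricalMeasure _ _ _ measurable_fst,
        (map_splitEmpiricalMeasure _ _ _ measurable_snd).trans
          (splitEmpiricalMeasure_self h0 h1 v)⟩).trans ?_
    rw [lintegral_splitEmpiricalMeasure]
    simp only [edist_self, mul_zero, add_zero, edist_dist]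
    simp_rw [← ENNReal.ofReal_mul (h0 _)]
    rw [inv_natCast_mul_sum_ofReal hH fun i => mul_nonneg (h0 i) dist_nonneg]
    exact ENNReal.ofReal_le_ofReal hcost

end Split

/-! ### Wasserstein duality for half-spaces -/

section Duality

variable {E : Type*} [NormedAddCommGroup E] [InnerProductSpace ℝ E] [MeasurableSpace E]
  [BorelSpace E]

/-- Weak duality for one coupling, obtained by integrating the pointwise inequality
`t * 1_{⟪ρ, x⟫ ≤ y} ≤ ‖ρ‖ * dist x z + (t - halfSpaceGap ρ y z)⁺`. The positive part is taken by
`ENNReal.ofReal`. -/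
theorem ofReal_mul_halfSpace_le_of_mem_couplings {F ν : Measure E} {π : Measure (E × E)}
    (hπ : π ∈ couplings F ν) (ρ : E) (y t : ℝ) :
    ENNReal.ofReal t * F {x | inner ℝ ρ x ≤ y} ≤
      ENNReal.ofReal ‖ρ‖ * ∫⁻ z, edist z.1 z.2 ∂π +
        ∫⁻ x, ENNReal.ofReal (t - halfSpaceGap ρ y x) ∂ν := by
  obtain ⟨-, hF, hν⟩ := hπ
  have hC : MeasurableSet {x : E | inner ℝ ρ x ≤ y} :=
    (isClosed_le (by fun_prop) continuous_const).measurableSet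
  have hgap : Measurable fun x : E => ENNReal.ofReal (t - halfSpaceGap ρ y x) := by
    have : Continuous fun x : E => t - halfSpaceGap ρ y x := by
      unfold halfSpaceGap
      fun_prop
    exact this.measurable.ennreal_ofReal
  rw [← hF, ← hν, Measure.map_apply measurable_fst hC, lintegral_map hgap measurable_snd,
    ← lintegral_indicator_const (measurable_fst hC),
    ← lintegral_const_mul' _ _ ENNReal.ofReal_ne_top,
    ← lintegral_add_right _ (hgap.fun_comp measurable_snd)]
  refine lintegral_mono fun z => ?_
  by_cases hz : z ∈ Prod.fst ⁻¹' {x : E | inner ℝ ρ x ≤ y}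
  · rw [Set.indicator_of_mem hz, edist_dist, ← ENNReal.ofReal_mul (norm_nonneg _)]
    refine le_trans (ENNReal.ofReal_le_ofReal ?_) ENNReal.ofReal_add_le
    have hz' : inner ℝ ρ z.1 ≤ y := hz
    have h1 : inner ℝ ρ (z.2 - z.1) ≤ ‖ρ‖ * dist z.1 z.2 := by
      rw [dist_comm, dist_eq_norm]
      exact real_inner_le_norm _ _
    rw [inner_sub_right] at h1
    have : halfSpaceGap ρ y z.2 ≤ ‖ρ‖ * dist z.1 z.2 :=
      max_le (by linarith) (by positivity)
    linarith
  · rw [Set.indicator_of_notMem hz]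
    exact zero_le

theorem measure_halfSpace_le_of_isDualMultiplier {H : ℕ} (hH : 0 < H) {ξ : Fin H → E}
    {θ ε : ℝ} (hθ : 0 < θ) {y : ℝ} {ρ : E} (hρ : ρ ≠ 0) {t : ℝ}
    (ht : IsDualMultiplier ξ θ ε y ρ t) {F : Measure E}
    (hF : F ∈ wassersteinBall (empiricalMeasure ξ) 1 θ) :
    F {x | inner ℝ ρ x ≤ y} ≤ ENNReal.ofReal ε := by
  obtain ⟨ht0, ht⟩ := ht
  have hsum : 0 ≤ 1 / (H : ℝ) * ∑ i, max (t - halfSpaceGap ρ y (ξ i)) 0 :=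
    mul_nonneg (by positivity) (Finset.sum_nonneg fun i _ => le_max_right _ _)
  -- `t = 0` would force `‖ρ‖ * θ ≤ 0`
  have htpos : 0 < t := by
    refine ht0.lt_of_ne' fun h => ?_
    have := mul_pos (norm_pos_iff.2 hρ) hθ
    rw [h, zero_mul] at ht
    rw [h] at hsum
    linarith
  have hW : (⨅ π ∈ couplings F (empiricalMeasure ξ), ∫⁻ z, edist z.1 z.2 ∂π) ≤
      ENNReal.ofReal θ := by
    simpa [wassersteinDist] using hF.2
  have hint : ∫⁻ x, ENNReal.ofReal (t - halfSpaceGap ρ y x) ∂empiricalMeasure ξ =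
      ENNReal.ofReal (1 / (H : ℝ) * ∑ i, max (t - halfSpaceGap ρ y (ξ i)) 0) := by
    rw [lintegral_empiricalMeasure, ← inv_natCast_mul_sum_ofReal hH fun i => le_max_right _ _]
    simp
  have hmain : ENNReal.ofReal t * F {x | inner ℝ ρ x ≤ y} ≤
      ENNReal.ofReal ‖ρ‖ * (⨅ π ∈ couplings F (empiricalMeasure ξ), ∫⁻ z, edist z.1 z.2 ∂π) +
        ∫⁻ x, ENNReal.ofReal (t - halfSpaceGap ρ y x) ∂empiricalMeasure ξ := by
    have h0 : ENNReal.ofReal ‖ρ‖ ≠ 0 := by simpa using hρ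
    rw [ENNReal.mul_iInf_of_ne h0 ENNReal.ofReal_ne_top, ENNReal.iInf_add]
    refine le_iInf fun π => ?_
    rw [ENNReal.mul_iInf_of_ne h0 ENNReal.ofReal_ne_top, ENNReal.iInf_add]
    exact le_iInf fun hπ => ofReal_mul_halfSpace_le_of_mem_couplings hπ ρ y t
  have h2 : ENNReal.ofReal t * F {x | inner ℝ ρ x ≤ y} ≤ ENNReal.ofReal t * ENNReal.ofReal ε := by
    refine hmain.trans ?_
    rw [hint, ← ENNReal.ofReal_mul ht0]
    refine (add_le_add (mul_le_mul_right hW _) le_rfl).trans ?_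
    rw [← ENNReal.ofReal_mul (norm_nonneg _), ← ENNReal.ofReal_add (by positivity) hsum]
    exact ENNReal.ofReal_le_ofReal ht
  exact (ENNReal.mul_le_mul_iff_right (by simpa using htpos) ENNReal.ofReal_ne_top).1 h2

end Duality

/-- Strong duality: if moving fractions of the scenarios to their projections within the budget
never puts mass more than `ε` on the half-space, the knapsack threshold is a dual multiplier. -/
theorem exists_isDualMultiplier_of_measure_halfSpace_le {E : Type*} [NormedAddCommGroup E]
    [InnerProductSpace ℝ E] [MeasurableSpace E] [BorelSpace E] {H : ℕ} (hH : 0 < H)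
    {ξ : Fin H → E} {θ ε : ℝ} (hε0 : 0 < ε) (hε1 : ε < 1) {y : ℝ} {ρ : E} (hρ : ρ ≠ 0)
    (h : ∀ F ∈ wassersteinBall (empiricalMeasure ξ) 1 θ,
      F {x | inner ℝ ρ x ≤ y} ≤ ENNReal.ofReal ε) :
    ∃ t, IsDualMultiplier ξ θ ε y ρ t := by
  have hH' : (0 : ℝ) < H := by exact_mod_cast hH
  have hρ' : 0 < ‖ρ‖ := norm_pos_iff.2 hρ
  obtain ⟨t, ht0, ht⟩ := exists_threshold_of_fractional_knapsack
    (g := fun i => halfSpaceGap ρ y (ξ i)) (fun i => halfSpaceGap_nonneg _ _ _)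
    (B := H * (‖ρ‖ * θ)) (m := H * ε) (by positivity)
    (by rw [Fintype.card_fin]; nlinarith) (by
      intro q h0 h1 hcost
      -- the orthogonal projections of the scenarios to the half-space
      let u : Fin H → E := fun i => ξ i - (halfSpaceGap ρ y (ξ i) / ‖ρ‖ ^ 2) • ρ
      have hu : ∀ i, inner ℝ ρ (u i) ≤ y := fun i => by
        simp only [u]
        rw [inner_sub_right, real_inner_smul_right, real_inner_self_eq_norm_sq,
          div_mul_cancel₀ _ (by positivity)]
        linarith [inner_sub_le_halfSpaceGap ρ y (ξ i)]
      have hd : ∀ i, dist (u i) (ξ i) = halfSpaceGap ρ y (ξ i) / ‖ρ‖ := fun i => by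
        simp only [u]
        rw [dist_eq_norm, sub_sub_cancel_left, norm_neg, norm_smul, Real.norm_of_nonneg
          (div_nonneg (halfSpaceGap_nonneg _ _ _) (by positivity))]
        field_simp
      have hball := h _ (splitEmpiricalMeasure_mem_wassersteinBall hH h0 h1 u ξ (θ := θ) (by
        simp_rw [hd, ← mul_div_assoc]
        rw [← Finset.sum_div, one_div, inv_mul_le_iff₀ hH', div_le_iff₀ hρ']
        linarith))
      have hmass : ENNReal.ofReal (1 / (H : ℝ) * ∑ i, q i) ≤
          splitEmpiricalMeasure q u ξ {x | inner ℝ ρ x ≤ y} := by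
        have hC : MeasurableSet {x : E | inner ℝ ρ x ≤ y} :=
          (isClosed_le (by fun_prop) continuous_const).measurableSet
        rw [← lintegral_indicator_one hC, lintegral_splitEmpiricalMeasure,
          ← inv_natCast_mul_sum_ofReal hH h0]
        refine mul_le_mul_right (Finset.sum_le_sum fun i _ => ?_) _
        rw [Set.indicator_of_mem (show u i ∈ {x : E | inner ℝ ρ x ≤ y} from hu i)]
        simp
      have := (ENNReal.ofReal_le_ofReal_iff hε0.le).1 (hmass.trans hball)
      rwa [one_div, inv_mul_le_iff₀ hH'] at this)
  refine ⟨t, ht0, ?_⟩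
  refine le_of_mul_le_mul_left (le_trans (le_of_eq ?_) (ht.trans (le_of_eq ?_))) hH'
  · field_simp
  · ring

theorem drccFeasible_wassersteinBall_iff {K : Type*} [Fintype K] {H : ℕ} (hH : 0 < H)
    {ξ : Fin H → EuclideanSpace ℝ K} {θ ε : ℝ} (hε0 : 0 < ε) (hε1 : ε < 1) (hθ : 0 < θ)
    {Q : Set (EuclideanSpace ℝ K)} {y : ℝ} {ρ : EuclideanSpace ℝ K} (hρQ : ρ ∈ Q)
    (hρ0 : ρ ≠ 0) :
    DRCCFeasible (wassersteinBall (empiricalMeasure ξ) 1 θ) ε Q y ρ ↔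
      ∃ t, IsDualMultiplier ξ θ ε y ρ t := by
  constructor
  · rintro ⟨h, -⟩
    exact exists_isDualMultiplier_of_measure_halfSpace_le hH hε0 hε1 hρ0 fun F hF =>
      (le_iSup₂ (f := fun (F : Measure (EuclideanSpace ℝ K))
        (_ : F ∈ wassersteinBall (empiricalMeasure ξ) 1 θ) => F {x | inner ℝ ρ x ≤ y}) F hF).trans h
  · rintro ⟨t, ht⟩
    exact ⟨iSup₂_le fun F hF => measure_halfSpace_le_of_isDualMultiplier hH hθ hρ0 ht hF, hρQ⟩

/-! ### Bounds on certificates and attainment -/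

section Multiplier

variable {E : Type*} [NormedAddCommGroup E] [InnerProductSpace ℝ E] {H : ℕ} {ξ : Fin H → E}
  {θ ε y : ℝ} {ρ : E} {t : ℝ}

theorem sub_le_average_max_sub (hH : 0 < H) {g : Fin H → ℝ} {C : ℝ} (hg : ∀ i, g i ≤ C)
    (t : ℝ) : t - C ≤ 1 / (H : ℝ) * ∑ i, max (t - g i) 0 := by
  have hH' : (0 : ℝ) < H := by exact_mod_cast hH
  rw [one_div, le_inv_mul_iff₀ hH']
  have : ∑ _i : Fin H, (t - C) ≤ ∑ i, max (t - g i) 0 :=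
    Finset.sum_le_sum fun i _ => (sub_le_sub_left (hg i) t).trans (le_max_left _ _)
  rwa [Finset.sum_const, Finset.card_univ, Fintype.card_fin, nsmul_eq_mul] at this

/-- If every gap is at least `‖ρ‖ * θ / ε`, this value is a multiplier, and clearly the smallest
one. -/
theorem isDualMultiplier_of_le_halfSpaceGap (hε : 0 < ε) (hθ : 0 < θ)
    (h : ∀ i, ‖ρ‖ * θ / ε ≤ halfSpaceGap ρ y (ξ i)) :
    IsDualMultiplier ξ θ ε y ρ (‖ρ‖ * θ / ε) := by
  refine ⟨by positivity, ?_⟩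
  rw [Finset.sum_eq_zero fun i _ => max_eq_right (sub_nonpos.2 (h i)), mul_zero, add_zero,
    div_mul_cancel₀ _ hε.ne']

/-- Since `ε < 1`, the half-space cannot contain all scenarios. This bounds `y` above. -/
theorem IsDualMultiplier.exists_lt_inner (hH : 0 < H) (hε : ε < 1) (hθ : 0 < θ) (hρ : ρ ≠ 0)
    (ht : IsDualMultiplier ξ θ ε y ρ t) : ∃ i, y < inner ℝ ρ (ξ i) := by
  by_contra! hcon
  have := sub_le_average_max_sub hH (g := fun i => halfSpaceGap ρ y (ξ i)) (C := 0)
    (fun i => max_le (sub_nonpos.2 (hcon i)) le_rfl) t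
  have := mul_pos (norm_pos_iff.2 hρ) hθ
  nlinarith [ht.1, ht.2]

theorem abs_inner_le_iSup_norm (hρ : ‖ρ‖ ≤ 1) (i : Fin H) :
    |inner ℝ ρ (ξ i)| ≤ ⨆ j, ‖ξ j‖ :=
  ((abs_real_inner_le_norm ρ (ξ i)).trans (mul_le_of_le_one_left (norm_nonneg _) hρ)).trans
    (le_ciSup (Set.finite_range fun j => ‖ξ j‖).bddAbove i)

/-- The best certified value is attained: for `y` above a value that every `ρ ∈ Q` can reach, both
`y` and the multiplier are bounded, so `(y, ρ, t)` ranges over a compact set. -/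
theorem exists_isGreatest_isDualMultiplier (hH : 0 < H) (hε0 : 0 < ε) (hε1 : ε < 1) (hθ : 0 < θ)
    (ξ : Fin H → E) {Q : Set E} (hQc : IsCompact Q) (hQn : Q.Nonempty)
    (hQ0 : ∀ ρ ∈ Q, ρ ≠ 0) (hQ1 : ∀ ρ ∈ Q, ‖ρ‖ ≤ 1) :
    ∃ v, IsGreatest {y | ∃ ρ ∈ Q, ∃ t, IsDualMultiplier ξ θ ε y ρ t} v := by
  set R := ⨆ j, ‖ξ j‖ with hR
  have hR0 : 0 ≤ R := Real.iSup_nonneg fun j => norm_nonneg _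
  have hin : ∀ ρ ∈ Q, ∀ i, |inner ℝ ρ (ξ i)| ≤ R := fun ρ hρ i =>
    abs_inner_le_iSup_norm (hQ1 ρ hρ) i
  have hle : ∀ ρ ∈ Q, ‖ρ‖ * θ / ε ≤ θ / ε := fun ρ hρ =>
    div_le_div_of_nonneg_right (mul_le_of_le_one_left hθ.le (hQ1 ρ hρ)) hε0.le
  have hc0 : 0 < θ / ε := by positivity
  -- below this value every `ρ` is feasible
  set y₀ := -R - θ / ε with hy₀
  have hfeas : ∀ ρ ∈ Q, IsDualMultiplier ξ θ ε y₀ ρ (‖ρ‖ * θ / ε) := fun ρ hρ =>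
    isDualMultiplier_of_le_halfSpaceGap hε0 hθ fun i => by
      have h1 := (abs_le.1 (hin ρ hρ i)).1
      have h2 := inner_sub_le_halfSpaceGap ρ y₀ (ξ i)
      linarith [hle ρ hρ]
  have hbox : ∀ y ρ t, y₀ ≤ y → ρ ∈ Q → IsDualMultiplier ξ θ ε y ρ t →
      y ≤ R ∧ t ≤ (R - y₀) / (1 - ε) := by
    intro y ρ t hy hρ ht
    obtain ⟨i, hi⟩ := ht.exists_lt_inner hH hε1 hθ (hQ0 ρ hρ)
    refine ⟨hi.le.trans ((le_abs_self _).trans (hin ρ hρ i)), ?_⟩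
    rw [le_div_iff₀ (sub_pos.2 hε1)]
    have := sub_le_average_max_sub hH (g := fun i => halfSpaceGap ρ y (ξ i)) (C := R - y₀)
      (fun i => max_le (by linarith [(abs_le.1 (hin ρ hρ i)).2]) (by linarith)) t
    have := mul_nonneg (norm_nonneg ρ) hθ.le
    linarith [ht.2]
  let Z : Set (ℝ × E × ℝ) := (Set.Icc y₀ R ×ˢ Q ×ˢ Set.Icc 0 ((R - y₀) / (1 - ε))) ∩
    {z | ‖z.2.1‖ * θ + 1 / (H : ℝ) * ∑ i, max (z.2.2 - halfSpaceGap z.2.1 z.1 (ξ i)) 0 ≤ z.2.2 * ε}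
  have hZ : IsCompact Z := by
    refine (isCompact_Icc.prod (hQc.prod isCompact_Icc)).inter_right (isClosed_le ?_ ?_)
    · unfold halfSpaceGap
      fun_prop
    · fun_prop
  have hmem : ∀ y ρ t, y₀ ≤ y → ρ ∈ Q → IsDualMultiplier ξ θ ε y ρ t → (y, ρ, t) ∈ Z :=
    fun y ρ t hy hρ ht => ⟨⟨⟨hy, (hbox y ρ t hy hρ ht).1⟩, hρ, ht.1, (hbox y ρ t hy hρ ht).2⟩, ht.2⟩
  obtain ⟨ρ₀, hρ₀⟩ := hQn
  have hZn : Z.Nonempty := ⟨_, hmem y₀ ρ₀ _ le_rfl hρ₀ (hfeas ρ₀ hρ₀)⟩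
  obtain ⟨v, ⟨z, hz, rfl⟩, hv⟩ := (hZ.image continuous_fst).exists_isGreatest (hZn.image _)
  refine ⟨z.1, ⟨z.2.1, hz.1.2.1, z.2.2, hz.1.2.2.1, hz.2⟩, ?_⟩
  rintro y ⟨ρ, hρ, t, ht⟩
  rcases le_total y₀ y with hy | hy
  · exact hv ⟨_, hmem y ρ t hy hρ ht, rfl⟩
  · exact hy.trans hz.1.1.1

end Multiplier

/-! ### The mixed-integer program -/

/-- The mixed-integer constraints say that `b i + t ≤ halfSpaceGap ρ y (ξ i)` with `b i ≤ 0`, so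
that `-b i` plays the role of `(t - halfSpaceGap ρ y (ξ i))⁺`; the point is that the constant `M` is
large enough not to cut off any pair `(y, ρ)`. -/
theorem exists_misocpFeasible_iff {K : Type*} [Fintype K] {H : ℕ} (hH : 0 < H)
    {ξ : Fin H → EuclideanSpace ℝ K} {θ ε : ℝ} (hε0 : 0 < ε) (hε1 : ε < 1) (hθ : 0 < θ)
    {Q : Set (EuclideanSpace ℝ K)} {y : ℝ} {ρ : EuclideanSpace ℝ K} (hρQ : ρ ∈ Q)
    (hρ0 : ρ ≠ 0) (hρ1 : ‖ρ‖ ≤ 1) :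
    (∃ (β t : ℝ) (b η : Fin H → ℝ), MISOCPFeasible ξ θ ε Q y ρ β t b η) ↔
      ∃ t, IsDualMultiplier ξ θ ε y ρ t := by
  have hH' : (0 : ℝ) < H := by exact_mod_cast hH
  constructor
  · rintro ⟨β, t, b, η, h⟩
    refine ⟨t, h.t_nonneg, ?_⟩
    have hb : ∀ i, max (t - halfSpaceGap ρ y (ξ i)) 0 ≤ -b i := fun i => by
      refine max_le ?_ (by linarith [h.b_nonpos i])
      have h1 := h.switch_off i
      have h2 := h.switch_on i
      have h3 := inner_sub_le_halfSpaceGap ρ y (ξ i)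
      have h4 := halfSpaceGap_nonneg ρ y (ξ i)
      rcases h.binary i with h0 | h0 <;> rw [h0] at h1 h2 <;> linarith
    have hs : 1 / (H : ℝ) * ∑ i, max (t - halfSpaceGap ρ y (ξ i)) 0 ≤
        1 / (H : ℝ) * ∑ i, -b i :=
      mul_le_mul_of_nonneg_left (Finset.sum_le_sum fun i _ => hb i) (by positivity)
    rw [Finset.sum_neg_distrib, mul_neg] at hs
    linarith [h.budget, mul_le_mul_of_nonneg_right h.cone hθ.le]
  · rintro ⟨t₀, ht₀⟩
    set R := ⨆ j, ‖ξ j‖ with hR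
    have hR0 : 0 ≤ R := Real.iSup_nonneg fun j => norm_nonneg _
    have hin : ∀ i, |inner ℝ ρ (ξ i)| ≤ R := abs_inner_le_iSup_norm hρ1
    have hle : ‖ρ‖ * θ / ε ≤ θ / ε :=
      div_le_div_of_nonneg_right (mul_le_of_le_one_left hθ.le hρ1) hε0.le
    have hc0 : 0 < θ / ε := by positivity
    have hM : bigM ξ θ ε = θ / ε + 2 * R := rfl
    obtain ⟨k, hk⟩ := ht₀.exists_lt_inner hH hε1 hθ hρ0
    have hkR := (abs_le.1 (hin k)).2
    -- if some gap is below `‖ρ‖ * θ / ε` then all of them are at most `M`, as they differ by at most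
    -- `2 * R`; otherwise `‖ρ‖ * θ / ε` is itself a multiplier, and it is at most `M`
    obtain ⟨t, ht, htM⟩ : ∃ t, IsDualMultiplier ξ θ ε y ρ t ∧
        ∀ i, min t (halfSpaceGap ρ y (ξ i)) ≤ bigM ξ θ ε := by
      by_cases hall : ∀ i, ‖ρ‖ * θ / ε ≤ halfSpaceGap ρ y (ξ i)
      · exact ⟨_, isDualMultiplier_of_le_halfSpaceGap hε0 hθ hall, fun i =>
          (min_le_left _ _).trans (by linarith)⟩
      · push Not at hall
        obtain ⟨j, hj⟩ := hall
        refine ⟨t₀, ht₀, fun i => (min_le_right _ _).trans (max_le ?_ (by linarith))⟩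
        have h1 := inner_sub_le_halfSpaceGap ρ y (ξ j)
        linarith [(abs_le.1 (hin i)).2, (abs_le.1 (hin j)).1]
    have hbt : ∀ i, -max (t - halfSpaceGap ρ y (ξ i)) 0 + t = min t (halfSpaceGap ρ y (ξ i)) :=
      fun i => by
        rcases le_total t (halfSpaceGap ρ y (ξ i)) with h | h
        · rw [max_eq_right (by linarith), min_eq_left h]; ring
        · rw [max_eq_left (by linarith), min_eq_right h]; ring
    refine ⟨‖ρ‖, t, fun i => -max (t - halfSpaceGap ρ y (ξ i)) 0,
      fun i => if y < inner ℝ ρ (ξ i) then 1 else 0, ?_, fun i => ?_, fun i => ?_, fun i => ?_,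
      le_rfl, ht.1, norm_pos_iff.2 hρ0, hρQ, fun i => neg_nonpos.2 (le_max_right _ _)⟩
    · rw [Finset.sum_neg_distrib, mul_neg, sub_neg_eq_add]
      exact ht.2
    · rw [hbt]
      split_ifs with h
      · rw [mul_one]
        exact htM i
      · rw [mul_zero]
        exact (min_le_right _ _).trans (max_le (by linarith) le_rfl)
    · rw [hbt]
      refine (min_le_right _ _).trans (max_le ?_ ?_)
      · split_ifs with h <;> linarith
      · split_ifs with h
        · linarith
        · -- here `M` has to absorb `y - ⟪ρ, ξ i⟫`, which is at most `2 * R` because `y < R`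
          linarith [(abs_le.1 (hin i)).1]
    · split_ifs <;> simp

/-! ### Equivalence of the two problems -/

theorem theorem4p2 {S : Type*} [Fintype S] [DecidableEq S] {A : S → Type*}
    [∀ s, Fintype (A s)] [∀ s, Nonempty (A s)]
    (α : ℝ) (hα0 : 0 < α) (hα1 : α < 1)
    (p : (s : S) → A s → S → ℝ) (hp0 : ∀ s a s', 0 ≤ p s a s') (hp1 : ∀ s a, ∑ s', p s a s' = 1)
    (γ : S → ℝ) (hγ0 : ∀ s, 0 ≤ γ s) (hγ1 : ∑ s, γ s = 1)
    (ε : ℝ) (hε0 : 0 < ε) (hε1 : ε < 1) (θ : ℝ) (hθ : 0 < θ)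
    {H : ℕ} (hH : 0 < H) (ξ : Fin H → EuclideanSpace ℝ (StateAction S A)) :
    (∀ (y : ℝ) (ρ : EuclideanSpace ℝ (StateAction S A)),
      DRCCFeasible (wassersteinBall (empiricalMeasure ξ) 1 θ) ε (occupationPolytope α p γ) y ρ ↔
        ∃ (β t : ℝ) (b η : Fin H → ℝ),
          MISOCPFeasible ξ θ ε (occupationPolytope α p γ) y ρ β t b η) ∧
    ∃ v : ℝ,
      IsLUB {y : ℝ | ∃ ρ, DRCCFeasible (wassersteinBall (empiricalMeasure ξ) 1 θ) ε
        (occupationPolytope α p γ) y ρ} v ∧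
      IsGreatest {y : ℝ | ∃ (ρ : EuclideanSpace ℝ (StateAction S A)) (β t : ℝ) (b η : Fin H → ℝ),
        MISOCPFeasible ξ θ ε (occupationPolytope α p γ) y ρ β t b η} v := by
  set Q := occupationPolytope α p γ with hQ
  have hsum : ∀ ρ ∈ Q, ∑ k, ρ k = 1 := fun ρ hρ =>
    sum_eq_one_of_mem_occupationPolytope hα1 hp1 hγ1 hρ
  have hQ0 : ∀ ρ ∈ Q, ρ ≠ 0 := by
    rintro ρ hρ rfl
    simpa using hsum 0 hρ
  have hQ1 : ∀ ρ ∈ Q, ‖ρ‖ ≤ 1 := fun ρ hρ =>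
    norm_le_one_of_nonneg_of_sum_eq_one hρ.2 (hsum ρ hρ)
  have hQc : IsCompact Q := (isCompact_closedBall 0 1).of_isClosed_subset
    (isClosed_occupationPolytope α p γ) fun ρ hρ => mem_closedBall_zero_iff.2 (hQ1 ρ hρ)
  have hiff : ∀ y ρ, DRCCFeasible (wassersteinBall (empiricalMeasure ξ) 1 θ) ε Q y ρ ↔
      ∃ (β t : ℝ) (b η : Fin H → ℝ), MISOCPFeasible ξ θ ε Q y ρ β t b η := fun y ρ => by
    by_cases hρ : ρ ∈ Q
    · rw [drccFeasible_wassersteinBall_iff hH hε0 hε1 hθ hρ (hQ0 ρ hρ),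
        exists_misocpFeasible_iff hH hε0 hε1 hθ hρ (hQ0 ρ hρ) (hQ1 ρ hρ)]
    · exact iff_of_false (fun h => hρ h.2) fun ⟨_, _, _, _, h⟩ => hρ h.mem
  obtain ⟨v, hv⟩ := exists_isGreatest_isDualMultiplier hH hε0 hε1 hθ ξ hQc
    (occupationPolytope_nonempty hα0 hα1 hp0 hp1 hγ0 hγ1) hQ0 hQ1
  have hset : {y : ℝ | ∃ ρ, DRCCFeasible (wassersteinBall (empiricalMeasure ξ) 1 θ) ε Q y ρ} =
      {y | ∃ ρ ∈ Q, ∃ t, IsDualMultiplier ξ θ ε y ρ t} := by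
    ext y
    refine exists_congr fun ρ => ⟨fun h => ⟨h.2, ?_⟩, fun ⟨hρ, h⟩ => ?_⟩
    · exact (drccFeasible_wassersteinBall_iff hH hε0 hε1 hθ h.2 (hQ0 ρ h.2)).1 h
    · exact (drccFeasible_wassersteinBall_iff hH hε0 hε1 hθ hρ (hQ0 ρ hρ)).2 h
  refine ⟨hiff, v, hset ▸ hv.isLUB, ?_⟩
  simp_rw [← hiff]
  exact hset ▸ hv
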